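/- For an integer $n>2$, a pairwise comparison matrix of order $n$ is a real matrix $\mathbf{A}=(a_{ij})_{n\times n}$ with $a_{ij}>0$ and $a_{ij}a_{ji}=1$ for all $i,j$. Let $\mathcal{A}$ be the set of all pairwise comparison matrices (of all orders $n>2$), and let $\mathcal{A}^{*}\subset\mathcal{A}$ be the set of consistent ones, i.e. those with $a_{ik}=a_{ij}a_{jk}$ for all $i,j,k$. Let $\lambda_{\max}(\mathbf{A})$ denote the maximum (real) eigenvalue of $\mathbf{A}$ and let $$CI(\mathbf{A})=\frac{\lambda_{\max}(\mathbf{A})-n}{n-1}$$ be Saaty's Consistency Index. **Proposition.** For every $\mathbf{A}\in\mathcal{A}$ of order $n$, $\lambda_{\max}(\mathbf{A})$ exists and is the principal eigenvalue (every complex eigenvalue of $\mathbf{A}$ has modulus at most $\lambda_{\max}(\mathbf{A})$), $\lambda_{\max}(\mathbf{A})\ge n$, and $\lambda_{\max}(\mathbf{A})=n$ if and only if $\mathbf{A}\in\mathcal{A}^{*}$. Moreover, $I=CI$ satisfies the following five axioms. * **A1.** There is a unique $\nu\in\mathbb{R}$ such that, for all $\mathbf{A}\in\mathcal{A}$, $I(\mathbf{A})=\nu$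 if and only if $\mathbf{A}\in\mathcal{A}^{*}$. * **A2.** $I(\mathbf{P}\mathbf{A}\mathbf{P}^{\mathrm T})=I(\mathbf{A})$ for all $\mathbf{A}\in\mathcal{A}$ and all permutation matrices $\mathbf{P}$ of the same order. * **A3.** $I(\mathbf{A}(b))\ge I(\mathbf{A})$ for all $\mathbf{A}\in\mathcal{A}$ and all real $b>1$, where $\mathbf{A}(b)=(a_{ij}^{b})$. * **A4.** For all $\mathbf{A}\in\mathcal{A}^{*}$ of order $n$ and all $p,q\in\{1,\dots,n\}$, let $\mathbf{A}_{pq}(\delta)$ be the matrix obtained from $\mathbf{A}$ by replacing $a_{pq}$ and $a_{qp}$ with $a_{pq}^{\delta}$ and $a_{qp}^{\delta}$. Then $\delta\mapsto I(\mathbf{A}_{pq}(\delta))$ is non-decreasing for $\delta>1$ and non-increasing for $\delta<1$. * **A5.** For each $n>2$, $I$ is a continuous function of the entries $a_{ij}$ on the set of pairwise comparison matrices of order $n$. -/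

import Mathlib

namespace PairwiseComparison

/-- Pairwise comparison matrices of order `n`: positive, reciprocal square matrices, with `n > 2`
(the set is empty for `n ≤ 2`). The family over all `n` is the set `𝒜` of all pairwise comparison
matrices. -/
def pcmSet (n : ℕ) : Set (Matrix (Fin n) (Fin n) ℝ) :=
  {A | (∀ i j, 0 < A i j) ∧ (∀ i j, A i j * A j i = 1) ∧ 2 < n}

/-- The type of pairwise comparison matrices of order `n`, with the topology induced from the space
of real `n × n` matrices. -/
abbrev PCM (n : ℕ) : Type := pcmSet n

/-- Consistency: `a_ik = a_ij * a_jk` for all `i, j, k`. -/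
def IsConsistent {n : ℕ} (A : PCM n) : Prop :=
  ∀ i j k, A.1 i k = A.1 i j * A.1 j k

/-- The maximum eigenvalue of a real square matrix: the supremum of its real (right) eigenvalues. -/
noncomputable def lambdaMax {n : ℕ} (A : Matrix (Fin n) (Fin n) ℝ) : ℝ :=
  sSup {μ : ℝ | Module.End.HasEigenvalue (Matrix.toLin' A) μ}

/-- `l` is the principal (Perron) eigenvalue of `A`: it is an eigenvalue of `A`, and every complex
eigenvalue of `A` has modulus at most `l`. -/
def IsPrincipalEigenvalue {n : ℕ} (A : Matrix (Fin n) (Fin n) ℝ) (l : ℝ) : Prop :=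
  Module.End.HasEigenvalue (Matrix.toLin' A) l ∧
    ∀ z : ℂ, Module.End.HasEigenvalue (Matrix.toLin' (A.map Complex.ofReal)) z → ‖z‖ ≤ l

/-- An inconsistency index: a real-valued function on the pairwise comparison matrices of all
orders. -/
abbrev InconsistencyIndex : Type := (n : ℕ) → PCM n → ℝ

/-- The Consistency Index `CI(A) = (λ_max - n) / (n - 1)`. -/
noncomputable def consistencyIndex : InconsistencyIndex :=
  fun n A => (lambdaMax A.1 - (n : ℝ)) / ((n : ℝ) - 1)

theorem permMatrix_conj_apply {n : ℕ} (σ : Equiv.Perm (Fin n)) (A : Matrix (Fin n) (Fin n) ℝ)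
    (i j : Fin n) :
    (σ.permMatrix ℝ * A * (σ.permMatrix ℝ).transpose) i j = A (σ i) (σ j) := by
  simp [Matrix.mul_apply, Equiv.Perm.permMatrix, PEquiv.toMatrix_apply, Equiv.toPEquiv_apply,
    Equiv.symm_apply_eq]

/-- The matrix `P A Pᵀ` for the permutation matrix `P` of `σ`. -/
def PCM.permute {n : ℕ} (A : PCM n) (σ : Equiv.Perm (Fin n)) : PCM n :=
  ⟨σ.permMatrix ℝ * A.1 * (σ.permMatrix ℝ).transpose,
    fun i j => by rw [permMatrix_conj_apply]; exact A.2.1 _ _,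
    fun i j => by rw [permMatrix_conj_apply, permMatrix_conj_apply]; exact A.2.2.1 _ _,
    A.2.2.2⟩

/-- The matrix `A(b) = (a_ij ^ b)`. -/
noncomputable def PCM.power {n : ℕ} (A : PCM n) (b : ℝ) : PCM n :=
  ⟨Matrix.of fun i j => A.1 i j ^ b,
    fun i j => Real.rpow_pos_of_pos (A.2.1 i j) b,
    fun i j => by
      simp only [Matrix.of_apply]
      rw [← Real.mul_rpow (A.2.1 i j).le (A.2.1 j i).le, A.2.2.1, Real.one_rpow],
    A.2.2.2⟩

/-- The matrix `A_pq(δ)`: the entries `a_pq` and `a_qp` of `A` are replaced with `a_pq ^ δ` and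
`a_qp ^ δ`, and all others are kept. -/
noncomputable def PCM.powerEntry {n : ℕ} (A : PCM n) (p q : Fin n) (δ : ℝ) : PCM n :=
  ⟨Matrix.of fun i j =>
      if (i = p ∧ j = q) ∨ (i = q ∧ j = p) then A.1 i j ^ δ else A.1 i j,
    fun i j => by
      simp only [Matrix.of_apply]
      split_ifs
      · exact Real.rpow_pos_of_pos (A.2.1 i j) δ
      · exact A.2.1 i j,
    fun i j => by
      have h : ((j = p ∧ i = q) ∨ (j = q ∧ i = p)) ↔ ((i = p ∧ j = q) ∨ (i = q ∧ j = p)) := by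
        tauto
      simp only [Matrix.of_apply, h]
      split_ifs
      · rw [← Real.mul_rpow (A.2.1 i j).le (A.2.1 j i).le, A.2.2.1, Real.one_rpow]
      · exact A.2.2.1 i j,
    A.2.2.2⟩

/-- A1: a unique real value identifies the consistent matrices (of all orders). -/
def SatisfiesA1 (I : InconsistencyIndex) : Prop :=
  ∃! ν : ℝ, ∀ (n : ℕ) (A : PCM n), I n A = ν ↔ IsConsistent A

/-- A2: invariance under permutation of the alternatives. -/
def SatisfiesA2 (I : InconsistencyIndex) : Prop :=
  ∀ (n : ℕ) (A : PCM n) (σ : Equiv.Perm (Fin n)), I n (A.permute σ) = I n A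

/-- A3: monotonicity under the intensification `A ↦ A(b)`, `b > 1`. -/
def SatisfiesA3 (I : InconsistencyIndex) : Prop :=
  ∀ (n : ℕ) (A : PCM n) (b : ℝ), 1 < b → I n A ≤ I n (A.power b)

/-- A4: for consistent `A`, the function `δ ↦ I(A_pq(δ))` is non-decreasing for `δ > 1` and
non-increasing for `δ < 1`. -/
def SatisfiesA4 (I : InconsistencyIndex) : Prop :=
  ∀ (n : ℕ) (A : PCM n), IsConsistent A → ∀ p q : Fin n,
    MonotoneOn (fun δ : ℝ => I n (A.powerEntry p q δ)) (Set.Ioi 1) ∧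
      AntitoneOn (fun δ : ℝ => I n (A.powerEntry p q δ)) (Set.Iio 1)

/-- A5: for each order, the index is a continuous function of the entries of the matrix, on the set
of pairwise comparison matrices. -/
def SatisfiesA5 (I : InconsistencyIndex) : Prop :=
  ∀ n : ℕ, Continuous (I n)

end PairwiseComparison

/-!
Everything rests on the Perron eigenpair of an entrywise positive matrix `A`: some `x > 0` satisfies
`A x = r x`. It is obtained by maximizing `r` over the compact set of pairs `(r, x)` with `x` in the
standard simplex and `r x ≤ A x`; if a maximal pair were not an eigenpair, the vector `A x` would
allow a larger `r` (`exists_pos_eigenvector`).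

The second ingredient is the Collatz–Wielandt comparison `le_of_subinvariant_of_superinvariant`: if
`A x ≤ μ x` for some `x > 0` and `l u ≤ A u` for some nonzero `u ≥ 0`, then `l ≤ μ`. With `u = |v|`
for an eigenvector `v` it bounds all complex eigenvalues, so that the Perron root is `λ_max`. It
also bounds `λ_max` from above by any `μ` with `A x ≤ μ x` (`lambdaMax_le`) and from below by any
`c` with `c x ≤ A x` (`le_lambdaMax`), for every `x > 0`. These two bounds give the rest.

* `λ_max ≥ n`: with `c_ij = a_ij x_j / x_i` for the Perron vector `x`, one has `c_ij c_ji = 1` and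
  `∑ c_ij = n λ_max`, so the claim is `c + 1 / c ≥ 2`; equality forces `a_ij = x_i / x_j`.
* A3: if `x` is the Perron vector of `A(b)` and `λ` its root, then concavity of `t ↦ t ^ (1 / b)`
  shows that `y_i = x_i ^ (1 / b)` satisfies `A y ≤ n ^ (1 - 1 / b) λ ^ (1 / b) y ≤ λ y`, where the
  last step uses `n ≤ λ`.
* A4: a consistent matrix is `a_ij = w_i / w_j`, and conjugation by `diag(w)` turns `A_pq(δ)` into
  a matrix `B_δ` with entries `a_pq ^ (δ - 1)`, `a_qp ^ (δ - 1)` and `1` elsewhere. Then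
  `B_δ' = B_δ(b)` with `b = (δ' - 1) / (δ - 1)`, which is at least `1` when `δ'` lies beyond `δ` on
  the same side of `1`, so the inequality behind A3 applies.
* A5: for the Perron vector `x` of `A`, a matrix `B` near `A` satisfies `c x < B x < d x` for any
  `c < λ_max(A) < d`, hence `c ≤ λ_max(B) ≤ d`.
-/

namespace PairwiseComparison

open Matrix

/-! ### Perron eigenpairs of positive matrices -/

/-- Collatz–Wielandt comparison: evaluate both inequalities at an index where `u i / x i` is
maximal. -/
theorem le_of_subinvariant_of_superinvariant {ι : Type*} [Fintype ι] {A : Matrix ι ι ℝ}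
    (hA : ∀ i j, 0 ≤ A i j) {x u : ι → ℝ} {μ l : ℝ} (hx : ∀ i, 0 < x i)
    (hAx : ∀ i, (A *ᵥ x) i ≤ μ * x i) (hu : ∀ i, 0 ≤ u i) (hu0 : u ≠ 0)
    (hAu : ∀ i, l * u i ≤ (A *ᵥ u) i) : l ≤ μ := by
  obtain ⟨k, hk⟩ := Function.ne_iff.mp hu0
  obtain ⟨i, -, hi⟩ := Finset.exists_max_image Finset.univ (fun i => u i / x i) ⟨k, by simp⟩
  have hM : 0 < u i / x i :=
    lt_of_lt_of_le (div_pos (lt_of_le_of_ne (hu k) (Ne.symm hk)) (hx k)) (hi k (by simp))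
  have hle : ∀ j, u j ≤ u i / x i * x j := fun j =>
    (div_le_iff₀ (hx j)).mp (hi j (Finset.mem_univ j))
  have h1 : (A *ᵥ u) i ≤ u i / x i * (A *ᵥ x) i := by
    simp only [mulVec, dotProduct, Finset.mul_sum]
    refine Finset.sum_le_sum fun j _ => ?_
    calc A i j * u j ≤ A i j * (u i / x i * x j) := mul_le_mul_of_nonneg_left (hle j) (hA i j)
      _ = _ := by ring
  have h2 : l * u i ≤ μ * u i := by
    calc l * u i ≤ u i / x i * (A *ᵥ x) i := (hAu i).trans h1
      _ ≤ u i / x i * (μ * x i) := mul_le_mul_of_nonneg_left (hAx i) hM.le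
      _ = μ * u i := by
        have := (hx i).ne'
        field_simp
  exact le_of_mul_le_mul_right h2 ((div_pos_iff_of_pos_right (hx i)).mp hM)

theorem mulVec_pos {ι : Type*} [Fintype ι] {A : Matrix ι ι ℝ} (hA : ∀ i j, 0 < A i j)
    {u : ι → ℝ} (hu : ∀ i, 0 ≤ u i) (hu0 : u ≠ 0) (i : ι) : 0 < (A *ᵥ u) i := by
  obtain ⟨k, hk⟩ := Function.ne_iff.mp hu0
  exact Finset.sum_pos' (fun j _ => mul_nonneg (hA i j).le (hu j))
    ⟨k, Finset.mem_univ k, mul_pos (hA i k) (lt_of_le_of_ne (hu k) (Ne.symm hk))⟩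

/-- Among all `r` such that `r x ≤ A x` for a vector `x` of the standard simplex there is a
largest one. -/
theorem exists_max_superinvariant {ι : Type*} [Fintype ι] [Nonempty ι] {A : Matrix ι ι ℝ}
    (hA : ∀ i j, 0 ≤ A i j) :
    ∃ (r : ℝ) (x : ι → ℝ), x ∈ stdSimplex ℝ ι ∧ (∀ i, r * x i ≤ (A *ᵥ x) i) ∧
      ∀ (s : ℝ) (y : ι → ℝ), y ∈ stdSimplex ℝ ι → (∀ i, s * y i ≤ (A *ᵥ y) i) → s ≤ r := by
  classical
  -- Summing `r * x i ≤ (A x) i` over `i` bounds `r` by the sum of all entries.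
  have hbound : ∀ (s : ℝ) (y : ι → ℝ), y ∈ stdSimplex ℝ ι → (∀ i, s * y i ≤ (A *ᵥ y) i) →
      s ≤ ∑ i, ∑ j, A i j := by
    intro s y hy h
    calc s = ∑ i, s * y i := by rw [← Finset.mul_sum, hy.2, mul_one]
      _ ≤ ∑ i, (A *ᵥ y) i := Finset.sum_le_sum fun i _ => h i
      _ ≤ ∑ i, ∑ j, A i j := by
        refine Finset.sum_le_sum fun i _ => Finset.sum_le_sum fun j _ => ?_
        refine mul_le_of_le_one_right (hA i j) ?_
        rw [← hy.2]
        exact Finset.single_le_sum (fun k _ => hy.1 k) (Finset.mem_univ j)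
  let K : Set (ℝ × (ι → ℝ)) :=
    (Set.Icc 0 (∑ i, ∑ j, A i j) ×ˢ stdSimplex ℝ ι) ∩ {p | ∀ i, p.1 * p.2 i ≤ (A *ᵥ p.2) i}
  have hK : IsCompact K := by
    refine (isCompact_Icc.prod (isCompact_stdSimplex ℝ ι)).inter_right ?_
    simp only [Set.ofPred_forall]
    refine isClosed_iInter fun i => isClosed_le (by fun_prop) ?_
    simp only [mulVec, dotProduct]
    fun_prop
  obtain ⟨k⟩ := ‹Nonempty ι›
  have h0 : ((0 : ℝ), Pi.single k (1 : ℝ)) ∈ K := by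
    have hs := single_mem_stdSimplex ℝ k
    refine ⟨⟨⟨le_rfl, Finset.sum_nonneg fun i _ => Finset.sum_nonneg fun j _ => hA i j⟩, hs⟩,
      fun i => ?_⟩
    rw [zero_mul]
    exact Finset.sum_nonneg fun j _ => mul_nonneg (hA i j) (hs.1 j)
  obtain ⟨⟨r, x⟩, ⟨⟨hr, hx⟩, hle⟩, hmax⟩ := hK.exists_isMaxOn ⟨_, h0⟩ continuous_fst.continuousOn
  refine ⟨r, x, hx, hle, fun s y hy h => ?_⟩
  rcases le_total s 0 with hs | hs
  · exact hs.trans hr.1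
  · exact hmax (show (s, y) ∈ K from ⟨⟨⟨hs, hbound s y hy h⟩, hy⟩, h⟩)

/-- Perron's theorem: a positive matrix has a positive eigenvector. -/
theorem exists_pos_eigenvector {ι : Type*} [Fintype ι] [Nonempty ι] {A : Matrix ι ι ℝ}
    (hA : ∀ i j, 0 < A i j) : ∃ (r : ℝ) (x : ι → ℝ), (∀ i, 0 < x i) ∧ A *ᵥ x = r • x := by
  obtain ⟨r, x, hx, hle, hmax⟩ := exists_max_superinvariant fun i j => (hA i j).le
  have hx0 : x ≠ 0 := by
    rintro rfl
    simpa using hx.2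
  have hypos : ∀ i, 0 < (A *ᵥ x) i := mulVec_pos hA hx.1 hx0
  have heig : A *ᵥ x = r • x := by
    by_contra hne
    have hsub : ∀ i, r * (A *ᵥ x) i < (A *ᵥ (A *ᵥ x)) i := by
      intro i
      have := mulVec_pos hA (u := A *ᵥ x - r • x) (fun i => sub_nonneg.mpr (hle i))
        (sub_ne_zero.mpr hne) i
      rw [mulVec_sub, mulVec_smul] at this
      simpa using this
    obtain ⟨k, -, hk⟩ := Finset.exists_min_image Finset.univ
      (fun i => (A *ᵥ (A *ᵥ x)) i / (A *ᵥ x) i) Finset.univ_nonempty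
    have hS : 0 < ∑ i, (A *ᵥ x) i := Finset.sum_pos (fun i _ => hypos i) Finset.univ_nonempty
    -- The vector `A x`, scaled into the simplex, beats the maximal `r`.
    have := hmax ((A *ᵥ (A *ᵥ x)) k / (A *ᵥ x) k) ((∑ i, (A *ᵥ x) i)⁻¹ • (A *ᵥ x))
      ⟨fun i => mul_nonneg (inv_pos.mpr hS).le (hypos i).le, by
        simp only [Pi.smul_apply, smul_eq_mul, ← Finset.mul_sum]
        exact inv_mul_cancel₀ hS.ne'⟩
      (fun i => by
        rw [mulVec_smul, Pi.smul_apply, Pi.smul_apply, smul_eq_mul, smul_eq_mul, mul_left_comm]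
        exact mul_le_mul_of_nonneg_left ((le_div_iff₀ (hypos i)).mp (hk i (Finset.mem_univ i)))
          (inv_pos.mpr hS).le)
    exact absurd ((lt_div_iff₀ (hypos k)).mpr (hsub k)) (not_lt.mpr this)
  refine ⟨r, x, fun i => lt_of_le_of_ne (hx.1 i) fun h => ?_, heig⟩
  have := hypos i
  rw [heig, Pi.smul_apply, ← h, smul_zero] at this
  exact lt_irrefl _ this

/-! ### The maximum eigenvalue -/

/-- A positive eigenvector of a nonnegative matrix belongs to an eigenvalue that dominates the
modulus of every complex eigenvalue. -/
theorem isPrincipalEigenvalue_of_pos_eigenvector {n : ℕ} [NeZero n]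
    {A : Matrix (Fin n) (Fin n) ℝ} (hA : ∀ i j, 0 ≤ A i j) {x : Fin n → ℝ} {r : ℝ}
    (hx : ∀ i, 0 < x i) (h : A *ᵥ x = r • x) : IsPrincipalEigenvalue A r := by
  refine ⟨Module.End.hasEigenvalue_of_hasEigenvector (x := x)
    ⟨Module.End.mem_eigenspace_iff.mpr (by rwa [toLin'_apply]), fun h0 => ?_⟩, fun z hz => ?_⟩
  · exact (hx 0).ne' (congrFun h0 0)
  · obtain ⟨v, hv⟩ := hz.exists_hasEigenvector
    have hvz : A.map Complex.ofReal *ᵥ v = z • v := by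
      simpa only [toLin'_apply] using hv.apply_eq_smul
    refine le_of_subinvariant_of_superinvariant hA hx (u := fun i => ‖v i‖)
      (fun i => by rw [h, Pi.smul_apply, smul_eq_mul]) (fun i => norm_nonneg _) ?_ fun i => ?_
    · intro h0
      exact hv.2 (funext fun i => norm_eq_zero.mp (congrFun h0 i))
    · have hi : ∑ j, (A i j : ℂ) * v j = z * v i := congrFun hvz i
      rw [← norm_mul, ← hi]
      refine (norm_sum_le _ _).trans (Finset.sum_le_sum fun j _ => ?_)
      rw [norm_mul, Complex.norm_real, Real.norm_of_nonneg (hA i j)]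

theorem lambdaMax_eq_of_pos_eigenvector {n : ℕ} [NeZero n]
    {A : Matrix (Fin n) (Fin n) ℝ} (hA : ∀ i j, 0 ≤ A i j) {x : Fin n → ℝ} {r : ℝ}
    (hx : ∀ i, 0 < x i) (h : A *ᵥ x = r • x) : lambdaMax A = r := by
  refine IsGreatest.csSup_eq
    ⟨(isPrincipalEigenvalue_of_pos_eigenvector hA hx h).1, fun μ hμ => ?_⟩
  obtain ⟨v, hv⟩ := Module.End.HasEigenvalue.exists_hasEigenvector hμ
  have hvμ : A *ᵥ v = μ • v := by simpa only [toLin'_apply] using hv.apply_eq_smul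
  refine (le_abs_self μ).trans (le_of_subinvariant_of_superinvariant hA hx (u := fun i => |v i|)
    (fun i => by rw [h, Pi.smul_apply, smul_eq_mul]) (fun i => abs_nonneg _) ?_ fun i => ?_)
  · intro h0
    exact hv.2 (funext fun i => abs_eq_zero.mp (congrFun h0 i))
  · have hi : ∑ j, A i j * v j = μ * v i := congrFun hvμ i
    rw [← abs_mul, ← hi]
    refine (Finset.abs_sum_le_sum_abs _ _).trans (Finset.sum_le_sum fun j _ => ?_)
    rw [abs_mul, abs_of_nonneg (hA i j)]

theorem exists_pos_eigenvector_lambdaMax {n : ℕ} [NeZero n] {A : Matrix (Fin n) (Fin n) ℝ}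
    (hA : ∀ i j, 0 < A i j) : ∃ x : Fin n → ℝ, (∀ i, 0 < x i) ∧ A *ᵥ x = lambdaMax A • x := by
  obtain ⟨r, x, hx, h⟩ := exists_pos_eigenvector hA
  exact ⟨x, hx, by rw [lambdaMax_eq_of_pos_eigenvector (fun i j => (hA i j).le) hx h, h]⟩

theorem lambdaMax_le {n : ℕ} [NeZero n] {A : Matrix (Fin n) (Fin n) ℝ} (hA : ∀ i j, 0 < A i j)
    {x : Fin n → ℝ} {μ : ℝ} (hx : ∀ i, 0 < x i) (h : ∀ i, (A *ᵥ x) i ≤ μ * x i) :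
    lambdaMax A ≤ μ := by
  obtain ⟨y, hy, hAy⟩ := exists_pos_eigenvector_lambdaMax hA
  exact le_of_subinvariant_of_superinvariant (fun i j => (hA i j).le) hx h (fun i => (hy i).le)
    (fun h0 => (hy 0).ne' (congrFun h0 0)) fun i => by rw [hAy, Pi.smul_apply, smul_eq_mul]

theorem le_lambdaMax {n : ℕ} [NeZero n] {A : Matrix (Fin n) (Fin n) ℝ} (hA : ∀ i j, 0 < A i j)
    {x : Fin n → ℝ} {c : ℝ} (hx : ∀ i, 0 < x i) (h : ∀ i, c * x i ≤ (A *ᵥ x) i) :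
    c ≤ lambdaMax A := by
  obtain ⟨y, hy, hAy⟩ := exists_pos_eigenvector_lambdaMax hA
  exact le_of_subinvariant_of_superinvariant (fun i j => (hA i j).le) hy
    (fun i => by rw [hAy, Pi.smul_apply, smul_eq_mul]) (fun i => (hx i).le)
    (fun h0 => (hx 0).ne' (congrFun h0 0)) h

/-! ### The bound `n ≤ λ_max` and consistency -/

theorem PCM.neZero {n : ℕ} (A : PCM n) : NeZero n := ⟨by have := A.2.2.2; omega⟩

/-- With `c_ij = a_ij x_j / x_i` for a positive eigenvector `x`, every row sum of `(c_ij)` is the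
eigenvalue `r`, so the terms `c_ij + c_ji - 2` measure the excess of `r` over `n`. -/
theorem sum_scaled_sub_two {n : ℕ} (A : PCM n) {x : Fin n → ℝ} {r : ℝ} (hx : ∀ i, 0 < x i)
    (h : A.1 *ᵥ x = r • x) :
    ∑ i, ∑ j, (A.1 i j * x j / x i + A.1 j i * x i / x j - 2) = 2 * n * (r - n) := by
  have h1 : ∀ i, ∑ j, A.1 i j * x j / x i = r := by
    intro i
    have hi : ∑ j, A.1 i j * x j = r * x i := congrFun h i
    rw [← Finset.sum_div, hi, mul_div_cancel_right₀ _ (hx i).ne']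
  have h2 : ∑ i, ∑ j, A.1 j i * x i / x j = ∑ i, ∑ j, A.1 i j * x j / x i := Finset.sum_comm
  simp only [Finset.sum_sub_distrib, Finset.sum_add_distrib, h2, h1]
  simp
  ring

theorem scaled_add_sub_two_nonneg {n : ℕ} (A : PCM n) {x : Fin n → ℝ} (hx : ∀ i, 0 < x i)
    (i j : Fin n) : 0 ≤ A.1 i j * x j / x i + A.1 j i * x i / x j - 2 := by
  have hi := hx i
  have hj := hx j
  have ha := A.2.1 i j
  have hb := A.2.1 j i
  have hmul : A.1 i j * x j / x i * (A.1 j i * x i / x j) = 1 := by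
    rw [← A.2.2.1 i j]
    field_simp
  have hc : 0 < A.1 i j * x j / x i := by positivity
  have hd : 0 < A.1 j i * x i / x j := by positivity
  nlinarith [sq_nonneg (A.1 i j * x j / x i - A.1 j i * x i / x j)]

theorem order_le_lambdaMax {n : ℕ} (A : PCM n) : (n : ℝ) ≤ lambdaMax A.1 := by
  have := A.neZero
  obtain ⟨x, hx, h⟩ := exists_pos_eigenvector_lambdaMax A.2.1
  have hs := sum_scaled_sub_two A hx h
  have h0 := Finset.sum_nonneg fun i (_ : i ∈ Finset.univ) =>
    Finset.sum_nonneg fun j (_ : j ∈ Finset.univ) => scaled_add_sub_two_nonneg A hx i j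
  rw [hs] at h0
  have hn : (0 : ℝ) < n := Nat.cast_pos.mpr (NeZero.pos n)
  exact sub_nonneg.mp (nonneg_of_mul_nonneg_right h0 (by positivity))

theorem lambdaMax_eq_of_isConsistent {n : ℕ} {A : PCM n} (hA : IsConsistent A) :
    lambdaMax A.1 = n := by
  have := A.neZero
  -- Each column of a consistent matrix is an eigenvector.
  refine lambdaMax_eq_of_pos_eigenvector (fun i j => (A.2.1 i j).le) (x := fun i => A.1 i 0)
    (fun i => A.2.1 i 0) (funext fun i => ?_)
  have h : ∑ j, A.1 i j * A.1 j 0 = n * A.1 i 0 := by simp [← hA i _ 0]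
  exact h

theorem isConsistent_of_lambdaMax_eq {n : ℕ} {A : PCM n} (hA : lambdaMax A.1 = n) :
    IsConsistent A := by
  have := A.neZero
  obtain ⟨x, hx, h⟩ := exists_pos_eigenvector_lambdaMax A.2.1
  have hs := sum_scaled_sub_two A hx h
  rw [hA, sub_self, mul_zero, Finset.sum_eq_zero_iff_of_nonneg fun i _ =>
    Finset.sum_nonneg fun j _ => scaled_add_sub_two_nonneg A hx i j] at hs
  have hentry : ∀ i j, A.1 i j = x i / x j := by
    intro i j
    have hij := (Finset.sum_eq_zero_iff_of_nonneg fun j _ =>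
      scaled_add_sub_two_nonneg A hx i j).mp (hs i (Finset.mem_univ i)) j (Finset.mem_univ j)
    have hi := (hx i).ne'
    have hj := (hx j).ne'
    have hmul : A.1 i j * x j / x i * (A.1 j i * x i / x j) = 1 := by
      rw [← A.2.2.1 i j]
      field_simp
    have hone : A.1 i j * x j / x i = 1 := by
      have : (A.1 i j * x j / x i - 1) ^ 2 = 0 := by
        linear_combination A.1 i j * x j / x i * hij - hmul
      exact sub_eq_zero.mp (pow_eq_zero_iff two_ne_zero |>.mp this)
    rw [eq_div_iff hj]
    rwa [div_eq_one_iff_eq hi] at hone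
  intro i j k
  have hj := (hx j).ne'
  have hk := (hx k).ne'
  rw [hentry, hentry i j, hentry j k]
  field_simp

theorem lambdaMax_eq_iff {n : ℕ} (A : PCM n) : lambdaMax A.1 = n ↔ IsConsistent A :=
  ⟨isConsistent_of_lambdaMax_eq, lambdaMax_eq_of_isConsistent⟩

theorem isPrincipalEigenvalue_lambdaMax {n : ℕ} (A : PCM n) :
    IsPrincipalEigenvalue A.1 (lambdaMax A.1) := by
  have := A.neZero
  obtain ⟨x, hx, h⟩ := exists_pos_eigenvector_lambdaMax A.2.1
  exact isPrincipalEigenvalue_of_pos_eigenvector (fun i j => (A.2.1 i j).le) hx h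

/-! ### The axioms -/

theorem PCM.sub_one_pos {n : ℕ} (A : PCM n) : (0 : ℝ) < (n : ℝ) - 1 := by
  have : (2 : ℝ) < n := by exact_mod_cast A.2.2.2
  linarith

theorem consistencyIndex_le {n : ℕ} {A B : PCM n} (h : lambdaMax A.1 ≤ lambdaMax B.1) :
    consistencyIndex n A ≤ consistencyIndex n B :=
  div_le_div_of_nonneg_right (sub_le_sub_right h _) A.sub_one_pos.le

theorem consistencyIndex_eq_zero_iff {n : ℕ} (A : PCM n) :
    consistencyIndex n A = 0 ↔ IsConsistent A := by
  rw [← lambdaMax_eq_iff, consistencyIndex, div_eq_zero_iff, or_iff_left A.sub_one_pos.ne',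
    sub_eq_zero]

theorem satisfiesA1_consistencyIndex : SatisfiesA1 consistencyIndex := by
  refine ⟨0, fun n A => consistencyIndex_eq_zero_iff A, fun ν hν => ?_⟩
  -- Any consistent matrix, such as the all-ones matrix of order 3, determines `ν`.
  let J : PCM 3 := ⟨Matrix.of fun _ _ => 1, by simp [pcmSet]⟩
  have hJ : IsConsistent J := fun i j k => by simp [J]
  rw [← (hν 3 J).mpr hJ, consistencyIndex_eq_zero_iff]
  exact hJ

theorem satisfiesA2_consistencyIndex : SatisfiesA2 consistencyIndex := by
  intro n A σ
  have := A.neZero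
  obtain ⟨x, hx, h⟩ := exists_pos_eigenvector_lambdaMax A.2.1
  have : lambdaMax (A.permute σ).1 = lambdaMax A.1 := by
    refine lambdaMax_eq_of_pos_eigenvector (fun i j => ((A.permute σ).2.1 i j).le)
      (x := fun i => x (σ i)) (fun i => hx _) (funext fun i => ?_)
    have hi : ∑ j, A.1 (σ i) j * x j = lambdaMax A.1 * x (σ i) := congrFun h (σ i)
    rw [← Equiv.sum_comp σ] at hi
    simpa only [mulVec, dotProduct, PCM.permute, permMatrix_conj_apply, Pi.smul_apply,
      smul_eq_mul] using hi
  rw [consistencyIndex, consistencyIndex, this]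

/-- The sub-invariant vector for `A` is the entrywise `b`-th root of the Perron vector of
`A(b)`. -/
theorem lambdaMax_le_lambdaMax_power {n : ℕ} (A : PCM n) {b : ℝ} (hb : 1 ≤ b) :
    lambdaMax A.1 ≤ lambdaMax (A.power b).1 := by
  have := A.neZero
  obtain ⟨x, hx, h⟩ := exists_pos_eigenvector_lambdaMax (A.power b).2.1
  have hle := order_le_lambdaMax (A.power b)
  set r := lambdaMax (A.power b).1
  have hn : (0 : ℝ) < n := Nat.cast_pos.mpr (NeZero.pos n)
  have hr : 0 < r := hn.trans_le hle
  have hb0 : 0 < b := one_pos.trans_le hb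
  refine lambdaMax_le A.2.1 (x := fun i => x i ^ b⁻¹) (fun i => Real.rpow_pos_of_pos (hx i) _)
    fun i => ?_
  have hpos : ∀ j, 0 < A.1 i j * x j ^ b⁻¹ := fun j =>
    mul_pos (A.2.1 i j) (Real.rpow_pos_of_pos (hx j) _)
  have hpow : ∀ j, (A.1 i j * x j ^ b⁻¹) ^ b = A.1 i j ^ b * x j := fun j => by
    rw [Real.mul_rpow (A.2.1 i j).le (Real.rpow_nonneg (hx j).le _), ← Real.rpow_mul (hx j).le,
      inv_mul_cancel₀ hb0.ne', Real.rpow_one]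
  have hi : ∑ j, A.1 i j ^ b * x j = r * x i := congrFun h i
  -- The power mean inequality bounds `(A y) i ^ b` for `y = x ^ b⁻¹`.
  have hmean := Real.rpow_sum_le_const_mul_sum_rpow_of_nonneg Finset.univ hb
    (f := fun j => A.1 i j * x j ^ b⁻¹) fun j _ => (hpos j).le
  simp only [hpow, hi, Finset.card_univ, Fintype.card_fin] at hmean
  have hsum0 : 0 ≤ ∑ j, A.1 i j * x j ^ b⁻¹ := Finset.sum_nonneg fun j _ => (hpos j).le
  have hrhs : 0 ≤ r * x i ^ b⁻¹ := mul_nonneg hr.le (Real.rpow_nonneg (hx i).le _)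
  refine (Real.rpow_le_rpow_iff hsum0 hrhs hb0).mp (hmean.trans ?_)
  rw [Real.mul_rpow hr.le (Real.rpow_nonneg (hx i).le _), ← Real.rpow_mul (hx i).le,
    inv_mul_cancel₀ hb0.ne', Real.rpow_one, ← mul_assoc]
  refine mul_le_mul_of_nonneg_right ?_ (hx i).le
  calc (n : ℝ) ^ (b - 1) * r ≤ r ^ (b - 1) * r :=
        mul_le_mul_of_nonneg_right (Real.rpow_le_rpow hn.le hle (sub_nonneg.mpr hb)) hr.le
    _ = r ^ b := by rw [Real.rpow_sub_one hr.ne', div_mul_cancel₀ _ hr.ne']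

theorem satisfiesA3_consistencyIndex : SatisfiesA3 consistencyIndex :=
  fun _ A _ hb => consistencyIndex_le (lambdaMax_le_lambdaMax_power A hb.le)

/-- The pairwise comparison matrix whose entries are `a_pq ^ s` at `(p, q)`, `a_qp ^ s` at
`(q, p)`, and `1` elsewhere. -/
noncomputable def PCM.pairPower {n : ℕ} (A : PCM n) (p q : Fin n) (s : ℝ) : PCM n :=
  ⟨Matrix.of fun i j => if (i = p ∧ j = q) ∨ (i = q ∧ j = p) then A.1 i j ^ s else 1,
    fun i j => by
      simp only [Matrix.of_apply]
      split_ifs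
      · exact Real.rpow_pos_of_pos (A.2.1 i j) s
      · exact one_pos,
    fun i j => by
      have h : ((j = p ∧ i = q) ∨ (j = q ∧ i = p)) ↔ ((i = p ∧ j = q) ∨ (i = q ∧ j = p)) := by
        tauto
      simp only [Matrix.of_apply, h]
      split_ifs
      · rw [← Real.mul_rpow (A.2.1 i j).le (A.2.1 j i).le, A.2.2.1, Real.one_rpow]
      · exact one_mul 1,
    A.2.2.2⟩

theorem PCM.pairPower_power {n : ℕ} (A : PCM n) (p q : Fin n) (s b : ℝ) :
    (A.pairPower p q s).power b = A.pairPower p q (s * b) := by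
  refine Subtype.ext (Matrix.ext fun i j => ?_)
  simp only [PCM.power, PCM.pairPower, Matrix.of_apply]
  split_ifs
  · rw [Real.rpow_mul (A.2.1 i j).le]
  · exact Real.one_rpow b

/-- For consistent `A`, a diagonal similarity carries `A_pq(δ)` to a matrix that differs from the
all-ones matrix only at `(p, q)` and `(q, p)`. -/
theorem lambdaMax_powerEntry {n : ℕ} {A : PCM n} (hA : IsConsistent A) (p q : Fin n) (δ : ℝ) :
    lambdaMax (A.powerEntry p q δ).1 = lambdaMax (A.pairPower p q (δ - 1)).1 := by
  have := A.neZero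
  obtain ⟨x, hx, h⟩ := exists_pos_eigenvector_lambdaMax (A.pairPower p q (δ - 1)).2.1
  have hentry : ∀ i j, (A.powerEntry p q δ).1 i j * A.1 j 0 =
      A.1 i 0 * (A.pairPower p q (δ - 1)).1 i j := by
    intro i j
    simp only [PCM.powerEntry, PCM.pairPower, Matrix.of_apply, hA i j 0]
    split_ifs
    · rw [Real.rpow_sub_one (A.2.1 i j).ne']
      have := (A.2.1 i j).ne'
      field_simp
    · ring
  refine lambdaMax_eq_of_pos_eigenvector (fun i j => ((A.powerEntry p q δ).2.1 i j).le)
    (x := fun i => A.1 i 0 * x i) (fun i => mul_pos (A.2.1 i 0) (hx i)) (funext fun i => ?_)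
  have hi : ∑ j, (A.pairPower p q (δ - 1)).1 i j * x j =
    lambdaMax (A.pairPower p q (δ - 1)).1 * x i := congrFun h i
  simp only [mulVec, dotProduct, Pi.smul_apply, smul_eq_mul, ← mul_assoc, hentry]
  simp only [mul_assoc, ← Finset.mul_sum, hi]
  ring

theorem lambdaMax_pairPower_le {n : ℕ} (A : PCM n) (p q : Fin n) {s t : ℝ} (hs : s ≠ 0)
    (h : 1 ≤ t / s) :
    lambdaMax (A.pairPower p q s).1 ≤ lambdaMax (A.pairPower p q t).1 := by
  have := lambdaMax_le_lambdaMax_power (A.pairPower p q s) h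
  rwa [PCM.pairPower_power, mul_div_cancel₀ t hs] at this

theorem satisfiesA4_consistencyIndex : SatisfiesA4 consistencyIndex := by
  refine fun n A hA p q => ⟨fun s hs t _ hst => ?_, fun s _ t ht hst => ?_⟩
  · refine consistencyIndex_le ?_
    rw [lambdaMax_powerEntry hA, lambdaMax_powerEntry hA]
    have hs' : 0 < s - 1 := sub_pos.mpr hs
    exact lambdaMax_pairPower_le A p q hs'.ne' ((one_le_div hs').mpr (by linarith))
  · refine consistencyIndex_le ?_
    rw [lambdaMax_powerEntry hA, lambdaMax_powerEntry hA]
    have ht' : t - 1 < 0 := sub_neg.mpr ht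
    exact lambdaMax_pairPower_le A p q ht'.ne ((one_le_div_of_neg ht').mpr (by linarith))

theorem continuous_lambdaMax (n : ℕ) : Continuous fun A : PCM n => lambdaMax A.1 := by
  refine continuous_iff_continuousAt.mpr fun A => ?_
  have := A.neZero
  obtain ⟨x, hx, h⟩ := exists_pos_eigenvector_lambdaMax A.2.1
  have hAx : ∀ i, (A.1 *ᵥ x) i = lambdaMax A.1 * x i := fun i => congrFun h i
  have hcont : ∀ i, Continuous fun B : PCM n => (B.1 *ᵥ x) i := fun i =>
    (continuous_apply i).comp (continuous_subtype_val.matrix_mulVec continuous_const)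
  refine tendsto_order.mpr ⟨fun c hc => ?_, fun d hd => ?_⟩
  · obtain ⟨c', hc, hc'⟩ := exists_between hc
    have : ∀ i, ∀ᶠ B : PCM n in nhds A, c' * x i < (B.1 *ᵥ x) i := fun i =>
      (hcont i).continuousAt.eventually_const_lt (by
        simp only [hAx]
        exact mul_lt_mul_of_pos_right hc' (hx i))
    filter_upwards [Filter.eventually_all.mpr this] with B hB
    exact hc.trans_le (le_lambdaMax B.2.1 hx fun i => (hB i).le)
  · obtain ⟨d', hd', hd⟩ := exists_between hd
    have : ∀ i, ∀ᶠ B : PCM n in nhds A, (B.1 *ᵥ x) i < d' * x i := fun i =>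
      (hcont i).continuousAt.eventually_lt_const (by
        simp only [hAx]
        exact mul_lt_mul_of_pos_right hd' (hx i))
    filter_upwards [Filter.eventually_all.mpr this] with B hB
    exact (lambdaMax_le B.2.1 hx fun i => (hB i).le).trans_lt hd

theorem satisfiesA5_consistencyIndex : SatisfiesA5 consistencyIndex :=
  fun n => ((continuous_lambdaMax n).sub continuous_const).div_const _

end PairwiseComparison

theorem mainTheorem2 :
    (∀ (n : ℕ) (A : PairwiseComparison.PCM n),
      PairwiseComparison.IsPrincipalEigenvalue A.1 (PairwiseComparison.lambdaMax A.1) ∧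
      (n : ℝ) ≤ PairwiseComparison.lambdaMax A.1 ∧
      (PairwiseComparison.lambdaMax A.1 = (n : ℝ) ↔ PairwiseComparison.IsConsistent A)) ∧
    PairwiseComparison.SatisfiesA1 PairwiseComparison.consistencyIndex ∧
    PairwiseComparison.SatisfiesA2 PairwiseComparison.consistencyIndex ∧
    PairwiseComparison.SatisfiesA3 PairwiseComparison.consistencyIndex ∧
    PairwiseComparison.SatisfiesA4 PairwiseComparison.consistencyIndex ∧
    PairwiseComparison.SatisfiesA5 PairwiseComparison.consistencyIndex :=
  ⟨fun _ A => ⟨PairwiseComparison.isPrincipalEigenvalue_lambdaMax A,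
      PairwiseComparison.order_le_lambdaMax A, PairwiseComparison.lambdaMax_eq_iff A⟩,
    PairwiseComparison.satisfiesA1_consistencyIndex,
    PairwiseComparison.satisfiesA2_consistencyIndex,
    PairwiseComparison.satisfiesA3_consistencyIndex,
    PairwiseComparison.satisfiesA4_consistencyIndex,
    PairwiseComparison.satisfiesA5_consistencyIndex⟩
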